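/- Let $k$ be a field, $n\ge 0$, and let $\mathbf a=(a_1,\dots,a_n)$ and $\mathbf b=(b_1,\dots,b_n)$ be vectors of positive integers. Let $A=k[x_{i,j} : 1\le i\le n,\ 0\le j\le a_i]$ with the $\mathbb Z^n$-grading in which $\deg x_{i,j}$ is the $i$-th unit vector; it is the Cox ring of $\mathbb P^{\mathbf a}=\mathbb P^{a_1}\times\cdots\times\mathbb P^{a_n}$. Let $I\subseteq A$ be a multigraded ideal having no primary component whose radical contains one of the ideals $(x_{i,0},\dots,x_{i,a_i})$, so that $I$ defines a closed subscheme $Z\subset\mathbb P^{\mathbf a}$. The correspondence scroll $C(Z;\mathbf b)\subseteq\mathbb P^N$, $N=\sum_i\binom{a_i+b_i}{a_i}-1$, is the projective scheme defined by the kernel of the $k$-algebra homomorphism $$k[z_{i,\alpha} : 1\le i\le n,\ \alpha\in\mathbb N^{a_i+1},\ |\alpha|=b_i]\longrightarrow A/I,\qquad z_{i,\alpha}\longmapsto x_{i,0}^{\alpha_0}\cdots x_{i,a_i}^{\alpha_{a_i}},$$ where the variables $z_{i,\alpha}$ have degree $1$. If $Z$ is a divisor of type $(d_1,\dots,d_n)\in\mathbb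 Z^n$, that is, an effective Cartier divisor on $\mathbb P^{\mathbf a}$ with associated line bundle $\mathcal O(d_1,\dots,d_n)$ (equivalently, the divisor of a nonzero rational section of $\mathcal O(d_1,\dots,d_n)$ that happens to be effective), then $$\deg C(Z;\mathbf b)=\sum_{i=1}^n d_i\, b_i^{a_i-1}\prod_{j\ne i} b_j^{a_j}.$$ Here the degree of a projective scheme with Hilbert polynomial $P$ is $(\deg P)!$ times the leading coefficient of $P$ (and $0$ for the empty scheme, where $P=0$). -/

import Mathlib

open scoped Nat

namespace CorrespondenceScroll

variable (k : Type*) [Field k] {n : ℕ} (a : Fin n → ℕ)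

/-- The polynomial ring `A = k[x_{i,j} : i = 1, …, n, 0 ≤ j ≤ a_i]`, the Cox ring of
`P^a = P^{a_1} × ⋯ × P^{a_n}`. -/
abbrev CoxRing : Type _ := MvPolynomial (Σ i : Fin n, Fin (a i + 1)) k

/-- The multidegree of the variable `x_{i,j}` is the `i`-th unit vector. -/
def multiweight (v : Σ i : Fin n, Fin (a i + 1)) : Fin n → ℕ := Pi.single v.1 1

variable {k a}

/-- `f` is a multihomogeneous form of multidegree `m`. -/
def IsForm (f : CoxRing k a) (m : Fin n → ℕ) : Prop :=
  MvPolynomial.IsWeightedHomogeneous (multiweight a) f m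

/-- `I` is a multigraded ideal: it contains all multihomogeneous components of its elements. -/
def IsMultigraded (I : Ideal (CoxRing k a)) : Prop :=
  ∀ f ∈ I, ∀ m : Fin n → ℕ,
    MvPolynomial.weightedHomogeneousComponent (multiweight a) m f ∈ I

/-- The ideal `(x_{i,0}, …, x_{i,a_i})`. -/
noncomputable def irrelevantIdeal (i : Fin n) : Ideal (CoxRing k a) :=
  Ideal.span (Set.range fun j : Fin (a i + 1) => MvPolynomial.X ⟨i, j⟩)

/-- No primary component of `I` has a radical containing one of the ideals
`(x_{i,0}, …, x_{i,a_i})`; the radicals of the primary components are the associated primes.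
For a multigraded ideal this says that `I` is the full multigraded ideal of a closed subscheme
of `P^a`. -/
def HasNoIrrelevantComponent (I : Ideal (CoxRing k a)) : Prop :=
  ∀ P ∈ Submodule.associatedPrimes I, ∀ i : Fin n, ¬ irrelevantIdeal i ≤ P

/-- The monomial `x_{1,c_1} ⋯ x_{n,c_n}`. The open sets where these monomials do not vanish are
the standard affine charts of `P^a`. -/
noncomputable def chartMonomial (c : ∀ i : Fin n, Fin (a i + 1)) : CoxRing k a :=
  ∏ i, MvPolynomial.X ⟨i, c i⟩

/-- The closed subscheme of `P^a` defined by the multigraded ideal `I` is a divisor of type `d`: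
it is the effective Cartier divisor `div(s)` of a nonzero rational section `s = G / H` of the
line bundle `O(d_1, …, d_n)`, i.e. on each standard chart its ideal is generated by `s`
(stated as `H · I = (G)`, since `H` is a nonzero element of a domain).
Equivalently, it is an effective Cartier divisor in the class `∑ d_i ζ_i`, where `ζ_i` is the class
of the hyperplane pulled back from the `i`-th factor. -/
def IsDivisorOfType (I : Ideal (CoxRing k a)) (d : Fin n → ℤ) : Prop :=
  ∃ (G H : CoxRing k a) (p q : Fin n → ℕ),
    G ≠ 0 ∧ H ≠ 0 ∧ IsForm G p ∧ IsForm H q ∧ (∀ i, (p i : ℤ) = q i + d i) ∧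
    ∀ c : (∀ i : Fin n, Fin (a i + 1)),
      (Ideal.span {H} * I).map (algebraMap _ (Localization.Away (chartMonomial (k := k) c))) =
        (Ideal.span {G}).map (algebraMap _ (Localization.Away (chartMonomial (k := k) c)))

/-- The indices `(i, α)` of the variables `z_{i,α}`: here `α` runs over the exponent vectors of
the monomials of degree `b_i` in `x_{i,0}, …, x_{i,a_i}`. -/
abbrev ScrollVar (a b : Fin n → ℕ) : Type :=
  Σ i : Fin n, {α : Fin (a i + 1) → ℕ // ∑ j, α j = b i}

/-- The map `S = k[z_{i,α}] → A / I` with `z_{i,α} ↦ x_{i,0}^{α_0} ⋯ x_{i,a_i}^{α_{a_i}}`. -/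
noncomputable def scrollMap (I : Ideal (CoxRing k a)) (b : Fin n → ℕ) :
    MvPolynomial (ScrollVar a b) k →ₐ[k] CoxRing k a ⧸ I :=
  MvPolynomial.aeval fun v =>
    Ideal.Quotient.mk I (∏ j, MvPolynomial.X ⟨v.1, j⟩ ^ v.2.1 j)

/-- The ideal of the correspondence scroll `C(Z; b) ⊆ P^N`, where `Z` is defined by `I`. -/
noncomputable def scrollIdeal (I : Ideal (CoxRing k a)) (b : Fin n → ℕ) :
    Ideal (MvPolynomial (ScrollVar a b) k) :=
  RingHom.ker (scrollMap I b)

/-- The Hilbert function `s ↦ dim_k (S / J)_s` of a homogeneous ideal `J` of a polynomial ring `S`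
whose variables have degree 1. -/
noncomputable def hilbertFunction {σ : Type*} (J : Ideal (MvPolynomial σ k)) (s : ℕ) : ℕ :=
  Module.finrank k
    ((MvPolynomial.homogeneousSubmodule σ k s).map (Ideal.Quotient.mkₐ k J).toLinearMap)

/-- The projective scheme defined by the homogeneous ideal `J` has degree `e`: its Hilbert
polynomial `P` exists and has leading coefficient `e / (deg P)!`
(so that the empty scheme, with `P = 0`, has degree `0`). -/
def HasDegree {σ : Type*} (J : Ideal (MvPolynomial σ k)) (e : ℤ) : Prop :=
  ∃ P : Polynomial ℚ,
    (∀ᶠ s : ℕ in Filter.atTop, P.eval (s : ℚ) = (hilbertFunction J s : ℚ)) ∧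
    (e : ℚ) = (P.natDegree)! * P.leadingCoeff

end CorrespondenceScroll

namespace CorrespondenceScroll

/-! Since every `a i ≥ 1`, the charts miss only a locus of codimension at least 2 in the spectrum of
the UFD A. Hence the ideal of a divisor is principal, I = (F) with F a form of multidegree d, and in
particular d ≥ 0 (`IsDivisorOfType.exists_eq_span`). The degree-s part of the scroll ring is the
image in A/(F) of the sum of the A_{mb} over |m| = s; what dies there is F times the sum of the
A_{mb-d}. So the Hilbert function is a difference of two monomial counts
(`hilbertFunction_add_card`).

The generating series of these counts are products over i (`card_shiftedExponents`) with factors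
p_i/(1-X)^{a_i+1} and q_i/(1-X)^{a_i+1}, where p_i(1) = q_i(1) = b_i^{a_i}. Pascal's rule gives p_i
- q_i = (1-X) r_i with r_i(1) = d_i b_i^{a_i-1}. Telescoping cancels one factor 1-X and leaves a
numerator whose value at 1 is the claimed number (`prod_mk_shiftedChoose_sub_prod`). If nonzero,
this value is the degree (`exists_polynomial_of_mk_eq`); it vanishes only for d = 0, when the scroll
is empty. -/

/-- The number of monomials of degree `m * b - d` in `a + 1` variables. -/
def shiftedChoose (a b d m : ℕ) : ℕ := if d ≤ m * b then (m * b - d + a).choose a else 0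

/-! ### Generating series with a pole at 1 -/

section Series

open PowerSeries

/-- Subtracting a multiple of the binomial polynomial of degree r kills the top coefficient. The
remainder has a pole of lower order, so its contribution to the numerator vanishes at 1. -/
theorem mk_eval_mul_one_sub_X_pow (r : ℕ) (P : Polynomial ℚ) (hP : P.natDegree ≤ r) :
    ∃ p : Polynomial ℚ, p.eval 1 = r ! * P.coeff r ∧
      (PowerSeries.mk fun m => P.eval (m : ℚ)) * (1 - X) ^ (r + 1) = (p : ℚ⟦X⟧) := by
  induction r generalizing P with
  | zero =>
    refine ⟨Polynomial.C (P.coeff 0), by simp, ?_⟩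
    rw [Polynomial.eq_C_of_natDegree_le_zero hP]
    have h := mk_one_mul_one_sub_eq_one ℚ
    have : (PowerSeries.mk fun m : ℕ => (Polynomial.C (P.coeff 0)).eval (m : ℚ)) =
        C (P.coeff 0) * PowerSeries.mk 1 := by
      ext m; simp
    rw [this, zero_add, pow_one, mul_assoc, h]
    simp
  | succ r ih =>
    set c : ℚ := (r + 1)! * P.coeff (r + 1) with hc
    set B := Polynomial.preHilbertPoly ℚ (r + 1) 0 with hB
    have hfac : ((r + 1)! : ℚ) ≠ 0 := by exact_mod_cast (r + 1).factorial_ne_zero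
    obtain ⟨p, -, hp⟩ := ih (P - c • B) (by
      have hd : (P - c • B).natDegree ≤ r + 1 := by
        refine (Polynomial.natDegree_sub_le _ _).trans (max_le hP ?_)
        exact (Polynomial.natDegree_smul_le _ _).trans
          (Polynomial.natDegree_preHilbertPoly ℚ (r + 1) 0).le
      refine Nat.lt_succ_iff.mp (lt_of_le_of_ne hd fun h => ?_)
      have hz : (P - c • B).coeff (r + 1) = 0 := by
        rw [Polynomial.coeff_sub, Polynomial.coeff_smul, hB,
          Polynomial.coeff_preHilbertPoly_self, hc, smul_eq_mul]
        field_simp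
        ring
      have h0 : P - c • B = 0 := by
        rw [← Polynomial.leadingCoeff_eq_zero, Polynomial.leadingCoeff, h, hz]
      simp [h0] at h)
    refine ⟨Polynomial.C c + (1 - Polynomial.X) * p, by simp, ?_⟩
    have hsplit : (PowerSeries.mk fun m : ℕ => P.eval (m : ℚ)) =
        C c * (PowerSeries.mk fun m => ((r + 1 + m).choose (r + 1) : ℚ)) +
          PowerSeries.mk fun m : ℕ => (P - c • B).eval (m : ℚ) := by
      ext m
      have := Polynomial.preHilbertPoly_eq_choose_sub_add ℚ (r + 1) (Nat.zero_le m)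
      simp only [map_add, coeff_C_mul, coeff_mk, Polynomial.eval_sub, Polynomial.eval_smul, hB,
        this, smul_eq_mul, Nat.sub_zero, add_comm m]
      ring
    rw [hsplit, add_mul, mul_assoc, mk_add_choose_mul_one_sub_pow_eq_one, pow_succ (1 - X) (r + 1),
      ← mul_assoc (PowerSeries.mk _), hp]
    simp [mul_comm]

/-- Finitely many exceptional values add a polynomial multiple of (1-X)^(r+1), invisible at 1. -/
theorem mk_mul_one_sub_X_pow_of_eventually_eval {f : ℕ → ℚ} {r N : ℕ} {P : Polynomial ℚ}
    (hP : P.natDegree ≤ r) (hf : ∀ m, N ≤ m → f m = P.eval (m : ℚ)) :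
    ∃ p : Polynomial ℚ, p.eval 1 = r ! * P.coeff r ∧
      PowerSeries.mk f * (1 - X) ^ (r + 1) = (p : ℚ⟦X⟧) := by
  obtain ⟨p, hp1, hp⟩ := mk_eval_mul_one_sub_X_pow r P hP
  set g : ℚ⟦X⟧ := PowerSeries.mk fun m => f m - P.eval (m : ℚ) with hg
  have hgt : ((trunc N g : Polynomial ℚ) : ℚ⟦X⟧) = g := by
    ext m
    rw [Polynomial.coeff_coe, coeff_trunc]
    split_ifs with h
    · rfl
    · rw [hg, coeff_mk, hf m (not_lt.mp h), sub_self]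
  refine ⟨p + trunc N g * (1 - Polynomial.X) ^ (r + 1), by simp [hp1], ?_⟩
  have : PowerSeries.mk f = (PowerSeries.mk fun m => P.eval (m : ℚ)) + g := by
    ext m; simp [hg]
  rw [this, add_mul, hp]
  simp [hgt]

theorem mk_shiftedChoose_mul_one_sub_X_pow (a b d : ℕ) (hb : 1 ≤ b) :
    ∃ p : Polynomial ℚ, p.eval 1 = (b : ℚ) ^ a ∧
      (PowerSeries.mk fun m => (shiftedChoose a b d m : ℚ)) * (1 - X) ^ (a + 1) = (p : ℚ⟦X⟧) := by
  have hb0 : (b : ℚ) ≠ 0 := by exact_mod_cast (by omega : b ≠ 0)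
  set L : Polynomial ℚ := Polynomial.C (b : ℚ) * Polynomial.X
  have hL : L.natDegree = 1 := Polynomial.natDegree_C_mul_X _ hb0
  set P := (Polynomial.preHilbertPoly ℚ a d).comp L with hPdef
  have hdeg : P.natDegree = a := by
    rw [Polynomial.natDegree_comp, hL, Polynomial.natDegree_preHilbertPoly, mul_one]
  have hcoeff : P.coeff a = (a ! : ℚ)⁻¹ * (b : ℚ) ^ a := by
    have h := Polynomial.leadingCoeff_comp (p := Polynomial.preHilbertPoly ℚ a d) (q := L)
      (by simp [hL])
    rw [Polynomial.leadingCoeff, ← hPdef, hdeg, Polynomial.leadingCoeff_preHilbertPoly,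
      Polynomial.natDegree_preHilbertPoly] at h
    rw [h, Polynomial.leadingCoeff_C_mul_X]
  have hfac : (a ! : ℚ) ≠ 0 := by exact_mod_cast a.factorial_ne_zero
  -- As b ≥ 1, m ≥ d already ensures d ≤ m * b, so the cutoff is inactive from `N := d` on.
  obtain ⟨p, hp1, hp⟩ := mk_mul_one_sub_X_pow_of_eventually_eval
    (f := fun m => (shiftedChoose a b d m : ℚ)) (N := d) hdeg.le (fun m hm => by
      have hle : d ≤ m * b := hm.trans (Nat.le_mul_of_pos_right m hb)
      have := Polynomial.preHilbertPoly_eq_choose_sub_add ℚ a hle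
      simp only [shiftedChoose, if_pos hle, hPdef, Polynomial.eval_comp, L, Polynomial.eval_mul,
        Polynomial.eval_C, Polynomial.eval_X]
      rw [← this]
      push_cast
      rw [mul_comm])
  exact ⟨p, by rw [hp1, hcoeff]; field_simp, hp⟩

/-- Pascal's rule; the cutoff to 0 makes it valid also at the boundary d = m * b and beyond. -/
theorem shiftedChoose_succ_left (a b d m : ℕ) :
    shiftedChoose (a + 1) b d m = shiftedChoose (a + 1) b (d + 1) m + shiftedChoose a b d m := by
  unfold shiftedChoose
  rcases lt_trichotomy d (m * b) with h | h | h
  · rw [if_pos h.le, if_pos (Nat.succ_le_of_lt h), if_pos h.le]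
    obtain ⟨e, he⟩ : ∃ e, m * b = d + 1 + e := ⟨m * b - (d + 1), by omega⟩
    rw [he, show d + 1 + e - d + (a + 1) = e + a + 1 + 1 by omega,
      show d + 1 + e - (d + 1) + (a + 1) = e + a + 1 by omega,
      show d + 1 + e - d + a = e + a + 1 by omega, Nat.choose_succ_succ, add_comm]
  · rw [if_pos h.le, if_neg (by omega), if_pos h.le, ← h]
    simp
  · rw [if_neg (by omega), if_neg (by omega), if_neg (by omega)]

theorem shiftedChoose_zero_eq (a b d m : ℕ) :
    shiftedChoose (a + 1) b 0 m =
      shiftedChoose (a + 1) b d m + ∑ j ∈ Finset.range d, shiftedChoose a b j m := by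
  induction d with
  | zero => simp
  | succ d ih => rw [ih, Finset.sum_range_succ, shiftedChoose_succ_left]; ring

theorem mk_sum_shiftedChoose_mul_one_sub_X_pow (a b d : ℕ) (hb : 1 ≤ b) :
    ∃ p : Polynomial ℚ, p.eval 1 = d * (b : ℚ) ^ a ∧
      (PowerSeries.mk fun m => ((∑ j ∈ Finset.range d, shiftedChoose a b j m : ℕ) : ℚ)) *
        (1 - X) ^ (a + 1) = (p : ℚ⟦X⟧) := by
  choose p hp1 hp using fun j => mk_shiftedChoose_mul_one_sub_X_pow a b j hb
  refine ⟨∑ j ∈ Finset.range d, p j, by simp [Polynomial.eval_finsetSum, hp1], ?_⟩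
  have : (PowerSeries.mk fun m => ((∑ j ∈ Finset.range d, shiftedChoose a b j m : ℕ) : ℚ)) =
      ∑ j ∈ Finset.range d, PowerSeries.mk fun m => (shiftedChoose a b j m : ℚ) := by
    ext m; simp
  rw [this, Finset.sum_mul, ← Polynomial.coeToPowerSeries.ringHom_apply, map_sum]
  exact Finset.sum_congr rfl fun j _ => hp j

/-- Telescoping the difference of two products whose factors differ by multiples of `1 - X`. -/
theorem prod_sub_prod_eq_one_sub_X_mul {ι : Type*} [DecidableEq ι] (s : Finset ι)
    (p q r : ι → Polynomial ℚ) (h : ∀ i, p i - q i = (1 - Polynomial.X) * r i) :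
    ∃ Q : Polynomial ℚ, ∏ i ∈ s, p i - ∏ i ∈ s, q i = (1 - Polynomial.X) * Q ∧
      Q.eval 1 = ∑ i ∈ s, (r i).eval 1 * ∏ j ∈ s.erase i, (p j).eval 1 := by
  induction s using Finset.induction_on with
  | empty => exact ⟨0, by simp⟩
  | insert x s hx ih =>
    obtain ⟨Q, hQ, hQ1⟩ := ih
    refine ⟨r x * ∏ i ∈ s, p i + q x * Q, ?_, ?_⟩
    · rw [Finset.prod_insert hx, Finset.prod_insert hx]
      linear_combination (∏ i ∈ s, p i) * h x + q x * hQ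
    · have hx1 : (q x).eval 1 = (p x).eval 1 := by
        have := congrArg (Polynomial.eval 1) (h x)
        simp only [Polynomial.eval_sub, Polynomial.eval_mul, Polynomial.eval_one,
          Polynomial.eval_X, sub_self, zero_mul] at this
        linarith
      rw [Finset.sum_insert hx, Finset.erase_insert hx]
      simp only [Polynomial.eval_add, Polynomial.eval_mul, Polynomial.eval_prod, hQ1, hx1,
        Finset.mul_sum]
      congr 1
      refine Finset.sum_congr rfl fun i hi => ?_
      have hne : x ≠ i := fun h => hx (h ▸ hi)
      rw [Finset.erase_insert_of_ne hne, Finset.prod_insert (by simp [hx])]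
      ring

/-- In each block the difference of the two counts is a sum of d_i counts in one variable fewer, so
its pole order drops by one. This supplies the r_i for the telescoping. -/
theorem prod_mk_shiftedChoose_sub_prod {n : ℕ} (a b d : Fin n → ℕ) (ha : ∀ i, 1 ≤ a i)
    (hb : ∀ i, 1 ≤ b i) :
    ∃ Q : Polynomial ℚ,
      (∏ i, (PowerSeries.mk fun m => (shiftedChoose (a i) (b i) 0 m : ℚ)) -
        ∏ i, PowerSeries.mk fun m => (shiftedChoose (a i) (b i) (d i) m : ℚ)) *
          (1 - X) ^ (∑ i, (a i + 1)) = (1 - X) * (Q : ℚ⟦X⟧) ∧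
      Q.eval 1 = ∑ i, (d i : ℚ) * (b i : ℚ) ^ (a i - 1) *
        ∏ j ∈ Finset.univ.erase i, (b j : ℚ) ^ a j := by
  choose p hp1 hp using fun i => mk_shiftedChoose_mul_one_sub_X_pow (a i) (b i) 0 (hb i)
  choose q hq1 hq using fun i => mk_shiftedChoose_mul_one_sub_X_pow (a i) (b i) (d i) (hb i)
  choose r hr1 hr using fun i => mk_sum_shiftedChoose_mul_one_sub_X_pow (a i - 1) (b i) (d i) (hb i)
  have hpqr : ∀ i, p i - q i = (1 - Polynomial.X) * r i := by
    intro i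
    apply Polynomial.coe_injective
    rw [Polynomial.coe_sub, Polynomial.coe_mul, ← hp, ← hq, ← hr, ← sub_mul,
      Nat.sub_add_cancel (ha i), pow_succ]
    have : (PowerSeries.mk fun m => (shiftedChoose (a i) (b i) 0 m : ℚ)) -
        (PowerSeries.mk fun m => (shiftedChoose (a i) (b i) (d i) m : ℚ)) =
        PowerSeries.mk fun m =>
          ((∑ j ∈ Finset.range (d i), shiftedChoose (a i - 1) (b i) j m : ℕ) : ℚ) := by
      ext m
      obtain ⟨a', ha'⟩ : ∃ a', a i = a' + 1 := ⟨a i - 1, by have := ha i; omega⟩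
      rw [ha', map_sub, coeff_mk, coeff_mk, coeff_mk, shiftedChoose_zero_eq a' (b i) (d i)]
      simp
    rw [this]
    simp only [Polynomial.coe_sub, Polynomial.coe_one, Polynomial.coe_X]
    ring
  obtain ⟨Q, hQ, hQ1⟩ := prod_sub_prod_eq_one_sub_X_mul Finset.univ p q r hpqr
  refine ⟨Q, ?_, by simp [hQ1, hr1, hp1]⟩
  rw [← Finset.prod_pow_eq_pow_sum, sub_mul, ← Finset.prod_mul_distrib, ← Finset.prod_mul_distrib]
  simp only [hp, hq]
  have := congrArg (Polynomial.coeToPowerSeries.ringHom (R := ℚ)) hQ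
  simpa only [map_sub, map_prod, map_mul, map_one, Polynomial.coeToPowerSeries.ringHom_apply,
    Polynomial.coe_X] using this

/-- The Hilbert polynomial attached to Q/(1-X)^(D+1) has D-th coefficient Q(1)/D!; Q(1) ≠ 0 makes
this the leading one. -/
theorem exists_polynomial_of_mk_eq {f : ℕ → ℚ} {D : ℕ} {Q : Polynomial ℚ}
    (hf : PowerSeries.mk f * (1 - X) ^ (D + 1) = (Q : ℚ⟦X⟧)) (hQ : Q.eval 1 ≠ 0) :
    ∃ P : Polynomial ℚ, (∀ᶠ s : ℕ in Filter.atTop, P.eval (s : ℚ) = f s) ∧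
      Q.eval 1 = P.natDegree ! * P.leadingCoeff := by
  have hfac : (D ! : ℚ) ≠ 0 := by exact_mod_cast D.factorial_ne_zero
  set P := Q.hilbertPoly (D + 1) with hP
  have hc : P.coeff D = Q.eval 1 * (D ! : ℚ)⁻¹ := by
    rw [hP, Polynomial.hilbertPoly_succ, Polynomial.finsetSum_coeff, Polynomial.eval_eq_sum,
      Polynomial.sum_def, Finset.sum_mul]
    simp [Polynomial.coeff_preHilbertPoly_self]
  have hdeg : P.natDegree = D := by
    apply Polynomial.natDegree_eq_of_le_of_coeff_ne_zero
    · rw [hP, Polynomial.hilbertPoly_succ]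
      refine Polynomial.natDegree_sum_le_of_forall_le _ _ fun i _ => ?_
      exact (Polynomial.natDegree_smul_le _ _).trans
        (Polynomial.natDegree_preHilbertPoly ℚ D i).le
    · rw [hc]
      exact mul_ne_zero hQ (inv_ne_zero hfac)
  refine ⟨P, ?_, ?_⟩
  · have hf' : PowerSeries.mk f = Q * (invOneSubPow ℚ (D + 1)).val := by
      rw [← hf, ← invOneSubPow_inv_eq_one_sub_pow, mul_assoc, Units.inv_val, mul_one]
    filter_upwards [Filter.eventually_gt_atTop Q.natDegree] with s hs
    rw [hP, ← Polynomial.coeff_mul_invOneSubPow_eq_hilbertPoly_eval _ hs, ← hf', coeff_mk]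
  · rw [Polynomial.leadingCoeff, hdeg, hc]
    field_simp

end Series

/-! ### The ideal of a divisor is principal -/

section DivisorIdeal

variable {k : Type*} [Field k] {n : ℕ} {a : Fin n → ℕ}

/-- A prime dividing a whole block of variables would be associated to both the first and the last
of them, which are distinct because a_i ≥ 1. -/
theorem exists_not_dvd_chartMonomial (ha : ∀ i, 1 ≤ a i) {p : CoxRing k a} (hp : Prime p) :
    ∃ c, ¬ p ∣ chartMonomial (k := k) c := by
  have key : ∀ i : Fin n, ∃ j : Fin (a i + 1), ¬ p ∣ MvPolynomial.X (R := k) ⟨i, j⟩ := by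
    intro i
    by_contra! h
    have hirr : ∀ j : Fin (a i + 1), Associated p (MvPolynomial.X (R := k) ⟨i, j⟩) := fun j =>
      hp.associated_of_dvd (MvPolynomial.X_prime) (h j)
    have hdvd := ((hirr 0).symm.trans (hirr (Fin.last _))).dvd
    rw [MvPolynomial.X_dvd_X] at hdvd
    have h0 := Fin.val_eq_of_eq (eq_of_heq (Sigma.mk.inj hdvd).2)
    have := ha i
    simp at h0
    omega
  choose c hc using key
  exact ⟨c, fun h => by
    obtain ⟨i, -, hi⟩ := hp.exists_mem_finset_dvd h
    exact hc i hi⟩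

/-- Divisibility can be tested on the charts: prime factors of F are peeled off one at a time, each
on a chart whose monomial it does not divide. -/
theorem dvd_of_forall_dvd_chartMonomial_pow_mul (ha : ∀ i, 1 ≤ a i) (F f : CoxRing k a)
    (h : ∀ c, ∃ m : ℕ, F ∣ chartMonomial c ^ m * f) : F ∣ f := by
  induction F using UniqueFactorizationMonoid.induction_on_prime generalizing f with
  | h₁ =>
    obtain ⟨m, hm⟩ := h 0
    have hne : chartMonomial (k := k) (a := a) 0 ≠ 0 :=
      Finset.prod_ne_zero_iff.mpr fun i _ => MvPolynomial.X_ne_zero _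
    rw [zero_dvd_iff, mul_eq_zero] at hm
    exact zero_dvd_iff.mpr (hm.resolve_left (pow_ne_zero _ hne))
  | h₂ u hu => exact hu.dvd
  | h₃ F p hF hp ih =>
    obtain ⟨c, hc⟩ := exists_not_dvd_chartMonomial ha hp
    obtain ⟨m, hm⟩ := h c
    obtain ⟨g, rfl⟩ : p ∣ f :=
      (hp.dvd_or_dvd ((dvd_mul_right p F).trans hm)).resolve_left fun h' =>
        hc (hp.dvd_of_dvd_pow h')
    refine mul_dvd_mul_left p (ih g fun c => ?_)
    obtain ⟨m, hm⟩ := h c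
    refine ⟨m, (mul_dvd_mul_iff_left hp.ne_zero).mp ?_⟩
    rwa [mul_left_comm] at hm

/-- If f ∉ I, its annihilator modulo I lies in an associated prime P. Picking from each block a
variable outside P gives a chart monomial no power of which lies in P. -/
theorem mem_of_forall_chartMonomial_pow_mul_mem {I : Ideal (CoxRing k a)}
    (hZ : HasNoIrrelevantComponent I) (f : CoxRing k a)
    (h : ∀ c, ∃ m : ℕ, chartMonomial c ^ m * f ∈ I) : f ∈ I := by
  by_contra hf
  obtain ⟨P, ⟨hP, y, hy⟩, hle⟩ := exists_le_isAssociatedPrime_of_isNoetherianRing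
    (CoxRing k a) (Ideal.Quotient.mk I f) (by rwa [Ne, Ideal.Quotient.eq_zero_iff_mem])
  obtain ⟨g, rfl⟩ := Ideal.Quotient.mk_surjective y
  have hmem : P ∈ Submodule.associatedPrimes I := by
    refine ⟨hP, g, ?_⟩
    rw [hy]
    congr 1
    ext r
    rw [Submodule.mem_colon_singleton, Submodule.mem_colon_singleton, Submodule.mem_bot,
      ← Ideal.Quotient.eq_zero_iff_mem, smul_eq_mul, map_mul]
    rfl
  have key : ∀ i, ∃ j : Fin (a i + 1), MvPolynomial.X (R := k) (⟨i, j⟩ : Σ i, Fin (a i + 1)) ∉ P := by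
    intro i
    by_contra! hX
    exact hZ P hmem i (Ideal.span_le.mpr (by rintro _ ⟨j, rfl⟩; exact hX j))
  choose c hc using key
  obtain ⟨m, hm⟩ := h c
  have hmP : chartMonomial c ^ m ∈ P := by
    apply hle
    rw [Submodule.mem_colon_singleton, Submodule.mem_bot]
    rw [← Ideal.Quotient.eq_zero_iff_mem, map_mul] at hm
    exact hm
  have h1 := hP.mem_of_pow_mem _ hmP
  obtain ⟨i, -, hi⟩ := (Ideal.IsPrime.prod_mem_iff (hp := hP)).mp h1
  exact hc i hi

theorem weightedHomogeneousComponent_add_mul {G : CoxRing k a} {p : Fin n → ℕ} (hG : IsForm G p)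
    (f : CoxRing k a) (w : Fin n → ℕ) :
    MvPolynomial.weightedHomogeneousComponent (multiweight a) (p + w) (G * f) =
      G * MvPolynomial.weightedHomogeneousComponent (multiweight a) w f := by
  classical
  let _ := MvPolynomial.weightedGradedAlgebra k (multiweight a)
  have h := DirectSum.coe_decompose_mul_add_of_left_mem
    (MvPolynomial.weightedHomogeneousSubmodule k (multiweight a)) (j := w) (b := f)
    ((MvPolynomial.mem_weightedHomogeneousSubmodule k (multiweight a) p G).mpr hG)
  have e := fun g m => MvPolynomial.weightedDecomposition.decompose'_apply k (w := multiweight a) g m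
  exact (e (G * f) (p + w)).symm.trans (h.trans (congrArg (G * ·) (e f w)))

/-- If a form `G` is divisible by a form `H ≠ 0`, the quotient is a form. -/
theorem exists_isForm_of_mul {H F : CoxRing k a} {p q : Fin n → ℕ} (hH : IsForm H q)
    (hHF : IsForm (H * F) p) (hne : H * F ≠ 0) : ∃ w, p = q + w ∧ IsForm F w := by
  classical
  have hH0 := left_ne_zero_of_mul hne
  have hcomp : ∀ w, p ≠ q + w →
      MvPolynomial.weightedHomogeneousComponent (multiweight a) w F = 0 := by
    intro w hw
    have h := weightedHomogeneousComponent_add_mul hH F w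
    rw [hHF.weightedHomogeneousComponent_ne _ hw.symm] at h
    exact (mul_eq_zero.mp h.symm).resolve_left hH0
  obtain ⟨w, hw⟩ : ∃ w, p = q + w := by
    by_contra! h
    apply right_ne_zero_of_mul hne
    rw [← MvPolynomial.sum_weightedHomogeneousComponent (multiweight a) F]
    exact (finsum_congr fun w => hcomp w (h w)).trans finsum_zero
  refine ⟨w, hw, ?_⟩
  have hF : F = MvPolynomial.weightedHomogeneousComponent (multiweight a) w F := by
    conv_lhs => rw [← MvPolynomial.sum_weightedHomogeneousComponent (multiweight a) F]
    exact finsum_eq_single _ w fun v hv => hcomp v fun h => hv (add_left_cancel (h.symm.trans hw))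
  rw [hF]
  exact MvPolynomial.weightedHomogeneousComponent_isWeightedHomogeneous w F

/-- The saturated ideal of a divisor is generated by one form, whose multidegree is the type. -/
theorem IsDivisorOfType.exists_eq_span (ha : ∀ i, 1 ≤ a i) {I : Ideal (CoxRing k a)}
    (hZ : HasNoIrrelevantComponent I) {d : Fin n → ℤ} (hd : IsDivisorOfType I d) :
    ∃ (F : CoxRing k a) (w : Fin n → ℕ), F ≠ 0 ∧ IsForm F w ∧ (∀ i, d i = w i) ∧
      I = Ideal.span {F} := by
  obtain ⟨G, H, p, q, hG, hH, hGp, hHq, hpq, hloc⟩ := hd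
  have hmap : ∀ c, ∀ x : CoxRing k a,
      (∃ m : ℕ, chartMonomial c ^ m * x ∈ Ideal.span {H} * I) ↔
        ∃ m : ℕ, chartMonomial c ^ m * x ∈ Ideal.span {G} := by
    intro c x
    have h1 : ∀ J : Ideal (CoxRing k a),
        (∃ m : ℕ, chartMonomial c ^ m * x ∈ J) ↔
          algebraMap _ (Localization.Away (chartMonomial (k := k) c)) x ∈
            J.map (algebraMap _ (Localization.Away (chartMonomial (k := k) c))) := by
      intro J
      rw [IsLocalization.algebraMap_mem_map_algebraMap_iff
        (Submonoid.powers (chartMonomial (k := k) c))]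
      simp [Submonoid.mem_powers_iff]
    rw [h1, h1, hloc c]
  -- On every chart G lies in H · I, hence in (H).
  have hHG : H ∣ G := by
    refine dvd_of_forall_dvd_chartMonomial_pow_mul ha H G fun c => ?_
    obtain ⟨m, hm⟩ := (hmap c G).mpr ⟨0, by simp⟩
    have hm' : chartMonomial c ^ m * G ∈ Ideal.span {H} := Ideal.mul_le_left (J := I) hm
    exact ⟨m, Ideal.mem_span_singleton.mp hm'⟩
  obtain ⟨F, rfl⟩ := hHG
  obtain ⟨w, hw, hF⟩ := exists_isForm_of_mul hHq hGp hG
  refine ⟨F, w, right_ne_zero_of_mul hG, hF, fun i => ?_, le_antisymm (fun f hf => ?_) ?_⟩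
  · have := hpq i
    rw [hw] at this
    simp only [Pi.add_apply, Nat.cast_add] at this
    omega
  · refine Ideal.mem_span_singleton.mpr (dvd_of_forall_dvd_chartMonomial_pow_mul ha F f fun c => ?_)
    obtain ⟨m, hm⟩ := (hmap c (H * f)).mp
      ⟨0, by simpa using Ideal.mul_mem_mul (Ideal.mem_span_singleton_self H) hf⟩
    rw [Ideal.mem_span_singleton, mul_left_comm] at hm
    exact ⟨m, (mul_dvd_mul_iff_left hH).mp hm⟩
  -- Chartwise membership of F in I descends to A because I has no irrelevant component.
  · rw [Ideal.span_singleton_le_iff_mem]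
    refine mem_of_forall_chartMonomial_pow_mul_mem hZ F fun c => ?_
    obtain ⟨m, hm⟩ := (hmap c (H * F)).mpr ⟨0, by simp⟩
    obtain ⟨z, hz, hzeq⟩ := Ideal.mem_span_singleton_mul.mp hm
    rw [mul_left_comm] at hzeq
    exact ⟨m, mul_left_cancel₀ hH hzeq ▸ hz⟩

end DivisorIdeal

/-! ### The Hilbert function as a difference of monomial counts -/

section HilbertFunction

variable {k : Type*} [Field k] {n : ℕ} {a : Fin n → ℕ}

theorem weight_multiweight_apply (e : (Σ i : Fin n, Fin (a i + 1)) →₀ ℕ) (i : Fin n) :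
    Finsupp.weight (multiweight a) e i = ∑ j, e ⟨i, j⟩ := by
  rw [Finsupp.weight_apply, Finsupp.sum_fintype _ _ (by simp), Finset.sum_apply,
    Fintype.sum_sigma, Finset.sum_eq_single i]
  · simp [multiweight]
  · intro i' _ hi'
    simp [multiweight, hi'.symm]
  · simp

/-- The exponents whose multidegree, shifted by `d`, is `m * b` for some `m` of total degree `s`. -/
def shiftedExponents (a b d : Fin n → ℕ) (s : ℕ) : Set ((Σ i : Fin n, Fin (a i + 1)) →₀ ℕ) :=
  {e | ∃ m : Fin n → ℕ, ∑ i, m i = s ∧ Finsupp.weight (multiweight a) e + d = m * b}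

/-- The exponent of the monomial in the variables `x_{i,j}` which is the image of `z_{i,α}`. -/
noncomputable def scrollExponent {b : Fin n → ℕ} (v : ScrollVar a b) :
    (Σ i : Fin n, Fin (a i + 1)) →₀ ℕ :=
  ∑ j, Finsupp.single ⟨v.1, j⟩ (v.2.1 j)

theorem weight_scrollExponent {b : Fin n → ℕ} (v : ScrollVar a b) :
    Finsupp.weight (multiweight a) (scrollExponent v) = Pi.single v.1 (b v.1) := by
  simp only [scrollExponent, map_sum, Finsupp.weight_single, multiweight, ← Finset.sum_smul, v.2.2]
  rw [← Pi.single_smul]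
  simp

theorem weight_weight_scrollExponent {b : Fin n → ℕ} (u : ScrollVar a b →₀ ℕ) :
    Finsupp.weight (multiweight a) (Finsupp.weight scrollExponent u) =
      Finsupp.weight (fun v : ScrollVar a b => (Pi.single v.1 1 : Fin n → ℕ)) u * b := by
  induction u using Finsupp.induction_linear with
  | zero => simp
  | add u v hu hv => simp only [map_add, hu, hv, add_mul]
  | single v c =>
    ext i
    simp only [Finsupp.weight_single, map_nsmul, weight_scrollExponent, Pi.smul_apply,
      Pi.mul_apply, smul_eq_mul]
    rcases eq_or_ne i v.1 with rfl | h
    · simp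
    · simp [h]

theorem sum_weight_single {b : Fin n → ℕ} (u : ScrollVar a b →₀ ℕ) :
    ∑ i, Finsupp.weight (fun v : ScrollVar a b => (Pi.single v.1 1 : Fin n → ℕ)) u i =
      u.degree := by
  induction u using Finsupp.induction_linear with
  | zero => simp
  | add u v hu hv => simp only [map_add, Pi.add_apply, Finset.sum_add_distrib, hu, hv]
  | single v c => simp [Finsupp.weight_single, ← Finset.mul_sum]

/-- Some m_i is positive when s > 0, so block i has degree at least b_i; a sub-exponent of degree
exactly b_i is the image of one variable z_{i,α}, which is split off. -/
theorem exists_weight_scrollExponent_eq {b : Fin n → ℕ} (s : ℕ)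
    (e : (Σ i : Fin n, Fin (a i + 1)) →₀ ℕ) (he : e ∈ shiftedExponents a b 0 s) :
    ∃ u : ScrollVar a b →₀ ℕ, u.degree = s ∧ Finsupp.weight scrollExponent u = e := by
  induction s generalizing e with
  | zero =>
    obtain ⟨m, hm, hme⟩ := he
    refine ⟨0, by simp, ?_⟩
    have hm0 : m = 0 := by
      ext i
      exact Finset.sum_eq_zero_iff.mp hm i (Finset.mem_univ i)
    rw [map_zero]
    ext ⟨i, j⟩
    have h := congrFun hme i
    rw [Pi.add_apply, weight_multiweight_apply, hm0, zero_mul, Pi.zero_apply, add_zero] at h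
    exact (Finset.sum_eq_zero_iff.mp h j (Finset.mem_univ j)).symm
  | succ s ih =>
    obtain ⟨m, hm, hme⟩ := he
    rw [add_zero] at hme
    obtain ⟨i, -, hi⟩ : ∃ i ∈ Finset.univ, m i ≠ 0 := by
      by_contra! h
      rw [Finset.sum_eq_zero h] at hm
      omega
    set f : Fin (a i + 1) →₀ ℕ := Finsupp.equivFunOnFinite.symm fun j => e ⟨i, j⟩ with hf
    have hfdeg : b i ≤ f.degree := by
      rw [Finsupp.degree_eq_sum]
      have h := congrFun hme i
      rw [weight_multiweight_apply, Pi.mul_apply] at h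
      simp only [hf, Finsupp.equivFunOnFinite_symm_apply_apply]
      rw [h]
      exact Nat.le_mul_of_pos_left _ (Nat.pos_of_ne_zero hi)
    obtain ⟨g, hg, hgdeg⟩ := Finsupp.exists_le_degree_eq f (b i) hfdeg
    let v : ScrollVar a b := ⟨i, ⟨g, by rw [← hgdeg, Finsupp.degree_eq_sum]⟩⟩
    have hle : scrollExponent v ≤ e := by
      rintro ⟨i', j⟩
      rw [scrollExponent, Finsupp.finsetSum_apply]
      rcases eq_or_ne i i' with rfl | h
      · rw [Finset.sum_eq_single j]
        · simpa [v, hf] using hg j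
        · intro j' _ hj'
          simp [v, hj']
        · simp
      · rw [Finset.sum_eq_zero]
        · exact Nat.zero_le _
        · intro j' _
          simp [v, h]
    obtain ⟨e', rfl⟩ := exists_add_of_le hle
    have hsingle : (Pi.single i 1 : Fin n → ℕ) ≤ m := by
      intro i'
      rcases eq_or_ne i' i with rfl | h
      · simpa using Nat.one_le_iff_ne_zero.mpr hi
      · simp [h]
    obtain ⟨m', rfl⟩ := exists_add_of_le hsingle
    obtain ⟨u, hu, rfl⟩ := ih e' ⟨m', by
        simp only [Pi.add_apply, Finset.sum_add_distrib, Finset.sum_pi_single', Finset.mem_univ,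
          if_true] at hm
        omega, by
        rw [map_add, weight_scrollExponent, add_mul] at hme
        have h1 : (Pi.single i 1 : Fin n → ℕ) * b = Pi.single i (b i) := by
          ext i'
          rcases eq_or_ne i' i with rfl | h
          · simp
          · simp [h]
        rw [h1] at hme
        rw [add_zero]
        exact add_left_cancel hme⟩
    exact ⟨Finsupp.single v 1 + u, by simp [hu, add_comm], by simp [Finsupp.weight_single]⟩

theorem aeval_monomial_eq {b : Fin n → ℕ} (u : ScrollVar a b →₀ ℕ) :
    MvPolynomial.aeval (fun v : ScrollVar a b =>
      (∏ j, MvPolynomial.X ⟨v.1, j⟩ ^ v.2.1 j : CoxRing k a)) (MvPolynomial.monomial u (1 : k)) =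
      MvPolynomial.monomial (Finsupp.weight scrollExponent u) 1 := by
  have h : ∀ v : ScrollVar a b, (∏ j, MvPolynomial.X ⟨v.1, j⟩ ^ v.2.1 j : CoxRing k a) =
      MvPolynomial.monomial (scrollExponent v) 1 := by
    intro v
    rw [scrollExponent, MvPolynomial.monomial_sum_one]
    exact Finset.prod_congr rfl fun j _ => MvPolynomial.X_pow_eq_monomial
  rw [MvPolynomial.aeval_monomial, map_one, one_mul, Finsupp.weight_apply, Finsupp.sum,
    MvPolynomial.monomial_sum_one, Finsupp.prod]
  refine Finset.prod_congr rfl fun v _ => ?_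
  rw [h, MvPolynomial.monomial_pow, one_pow]

theorem map_aeval_homogeneousSubmodule (b : Fin n → ℕ) (s : ℕ) :
    (MvPolynomial.homogeneousSubmodule (ScrollVar a b) k s).map
      (MvPolynomial.aeval fun v : ScrollVar a b =>
        (∏ j, MvPolynomial.X ⟨v.1, j⟩ ^ v.2.1 j : CoxRing k a)).toLinearMap =
      MvPolynomial.restrictSupport k (shiftedExponents a b 0 s) := by
  have h : MvPolynomial.homogeneousSubmodule (ScrollVar a b) k s =
      MvPolynomial.restrictSupport k {u | u.degree = s} :=
    MvPolynomial.homogeneousSubmodule_eq_finsupp_supported _ _ s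
  rw [h, MvPolynomial.restrictSupport_eq_span, MvPolynomial.restrictSupport_eq_span,
    Submodule.map_span, Set.image_image]
  congr 1
  ext f
  constructor
  · rintro ⟨u, hu, rfl⟩
    refine ⟨Finsupp.weight scrollExponent u, ⟨_, (sum_weight_single u).trans hu, ?_⟩,
      (aeval_monomial_eq u).symm⟩
    rw [add_zero, weight_weight_scrollExponent]
  · rintro ⟨e, he, rfl⟩
    obtain ⟨u, hu, rfl⟩ := exists_weight_scrollExponent_eq s e he
    exact ⟨u, hu, aeval_monomial_eq u⟩

theorem finrank_restrictSupport {σ : Type*} (E : Set (σ →₀ ℕ)) :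
    Module.finrank k (MvPolynomial.restrictSupport k E) = Nat.card E :=
  Module.finrank_eq_nat_card_basis (MvPolynomial.basisRestrictSupport k E)

/-- Multiplication by F shifts multidegrees by d and, A being a domain, kills no nonzero component.
-/
theorem mul_mem_restrictSupport_shiftedExponents_iff {b d : Fin n → ℕ} {F : CoxRing k a}
    (hF0 : F ≠ 0) (hF : IsForm F d) (s : ℕ) (g : CoxRing k a) :
    F * g ∈ MvPolynomial.restrictSupport k (shiftedExponents a b 0 s) ↔
      g ∈ MvPolynomial.restrictSupport k (shiftedExponents a b d s) := by
  classical
  simp only [MvPolynomial.mem_restrictSupport_iff]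
  constructor
  · intro h e he
    by_contra hne
    set w := Finsupp.weight (multiweight a) e with hw
    have hcomp : MvPolynomial.weightedHomogeneousComponent (multiweight a) w g ≠ 0 := by
      intro h0
      have := congrArg (MvPolynomial.coeff e) h0
      rw [MvPolynomial.coeff_weightedHomogeneousComponent, if_pos hw.symm] at this
      exact MvPolynomial.mem_support_iff.mp he this
    have hmul := weightedHomogeneousComponent_add_mul hF g w
    apply mul_ne_zero hF0 hcomp
    rw [← hmul]
    refine MvPolynomial.weightedHomogeneousComponent_eq_zero' _ _ fun e' he' heq => ?_
    obtain ⟨m, hm, hme⟩ := h he'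
    exact hne ⟨m, hm, by rw [← hme, heq, add_zero, add_comm]⟩
  · intro h e he
    obtain ⟨e₁, he₁, e₂, he₂, rfl⟩ := Finset.mem_add.mp (MvPolynomial.support_mul _ _ he)
    obtain ⟨m, hm, hme⟩ := h he₂
    refine ⟨m, hm, ?_⟩
    rw [map_add, hF (MvPolynomial.mem_support_iff.mp he₁), ← hme, add_zero, add_comm]

theorem finite_shiftedExponents (b d : Fin n → ℕ) (s : ℕ) :
    (shiftedExponents a b d s).Finite := by
  refine (Set.finite_Iic (Finsupp.equivFunOnFinite.symm
    fun v : (Σ i : Fin n, Fin (a i + 1)) => s * b v.1)).subset ?_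
  rintro e ⟨m, hm, hme⟩ ⟨i, j⟩
  have h := congrFun hme i
  rw [Pi.add_apply, weight_multiweight_apply, Pi.mul_apply] at h
  have h1 : e ⟨i, j⟩ ≤ ∑ j, e ⟨i, j⟩ :=
    Finset.single_le_sum (f := fun j => e ⟨i, j⟩) (fun _ _ => Nat.zero_le _) (Finset.mem_univ j)
  have h2 : m i ≤ s := hm ▸ Finset.single_le_sum (fun _ _ => Nat.zero_le _) (Finset.mem_univ i)
  have h3 := Nat.mul_le_mul_right (b i) h2
  simp only [Finsupp.equivFunOnFinite_symm_apply_apply]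
  omega

/-- The quotient by the kernel of `scrollMap` embeds in A/I, so dimensions can be computed there. -/
theorem hilbertFunction_scrollIdeal_eq (I : Ideal (CoxRing k a)) (b : Fin n → ℕ) (s : ℕ) :
    hilbertFunction (scrollIdeal I b) s =
      Module.finrank k ((MvPolynomial.restrictSupport k (shiftedExponents a b 0 s)).map
        (Ideal.Quotient.mkₐ k I).toLinearMap) := by
  have hcomp : scrollMap I b = (Ideal.Quotient.mkₐ k I).comp
      (MvPolynomial.aeval fun v : ScrollVar a b =>
        (∏ j, MvPolynomial.X ⟨v.1, j⟩ ^ v.2.1 j : CoxRing k a)) := by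
    apply MvPolynomial.algHom_ext
    intro v
    simp [scrollMap]
  have hlift : scrollMap I b = (Ideal.kerLiftAlg (scrollMap I b)).comp
      (Ideal.Quotient.mkₐ k (RingHom.ker (scrollMap I b))) := by
    apply MvPolynomial.algHom_ext
    intro v
    rfl
  change Module.finrank k ((MvPolynomial.homogeneousSubmodule (ScrollVar a b) k s).map
    (Ideal.Quotient.mkₐ k (RingHom.ker (scrollMap I b))).toLinearMap) = _
  rw [← map_aeval_homogeneousSubmodule, ← Submodule.map_comp, ← AlgHom.comp_toLinearMap, ← hcomp]
  conv_rhs => rw [hlift, AlgHom.comp_toLinearMap, Submodule.map_comp]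
  exact (LinearEquiv.finrank_eq (Submodule.equivMapOfInjective _
    (Ideal.kerLiftAlg_injective (scrollMap I b)) _))

/-- Rank-nullity for V → A/(F): the kernel V ∩ (F) equals F · W, which has the dimension of W. -/
theorem hilbertFunction_add_card {b d : Fin n → ℕ} {F : CoxRing k a}
    (hF0 : F ≠ 0) (hF : IsForm F d) (s : ℕ) :
    hilbertFunction (scrollIdeal (Ideal.span {F}) b) s + Nat.card (shiftedExponents a b d s) =
      Nat.card (shiftedExponents a b 0 s) := by
  set V := MvPolynomial.restrictSupport k (shiftedExponents a b 0 s)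
  set W := MvPolynomial.restrictSupport k (shiftedExponents a b d s)
  set q := (Ideal.Quotient.mkₐ k (Ideal.span {F})).toLinearMap
  have : Finite (shiftedExponents a b 0 s) := finite_shiftedExponents b 0 s
  have : FiniteDimensional k V :=
    Module.Finite.of_basis (MvPolynomial.basisRestrictSupport k (shiftedExponents a b 0 s))
  have hrange := LinearMap.finrank_range_add_finrank_ker (q.domRestrict V)
  rw [LinearMap.range_domRestrict] at hrange
  have hker : Module.finrank k (LinearMap.ker (q.domRestrict V)) = Module.finrank k W := by
    have hVW : (LinearMap.ker (q.domRestrict V)).map V.subtype =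
        W.map (LinearMap.mulLeft k F) := by
      ext f
      simp only [Submodule.mem_map, LinearMap.mem_ker, LinearMap.domRestrict_apply,
        Submodule.subtype_apply, LinearMap.mulLeft_apply, Subtype.exists, exists_and_right,
        exists_eq_right]
      have hq : q f = 0 ↔ F ∣ f := by
        rw [← Ideal.mem_span_singleton, ← Ideal.Quotient.eq_zero_iff_mem]
        rfl
      constructor
      · rintro ⟨hfV, hf⟩
        obtain ⟨g, rfl⟩ := hq.mp hf
        exact ⟨g, (mul_mem_restrictSupport_shiftedExponents_iff hF0 hF s g).mp hfV, rfl⟩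
      · rintro ⟨g, hg, rfl⟩
        exact ⟨(mul_mem_restrictSupport_shiftedExponents_iff hF0 hF s g).mpr hg,
          hq.mpr (dvd_mul_right F g)⟩
    rw [(Submodule.equivMapOfInjective V.subtype V.injective_subtype _).finrank_eq, hVW]
    exact (Submodule.equivMapOfInjective (LinearMap.mulLeft k F)
      (mul_right_injective₀ hF0) W).finrank_eq.symm
  rw [hker, finrank_restrictSupport, finrank_restrictSupport] at hrange
  rw [hilbertFunction_scrollIdeal_eq]
  exact hrange

theorem card_functions_sum_add (a b d m : ℕ) :
    Nat.card {u : Fin (a + 1) → ℕ // ∑ j, u j + d = m * b} = shiftedChoose a b d m := by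
  classical
  unfold shiftedChoose
  split_ifs with h
  · have e : {u : Fin (a + 1) → ℕ // ∑ j, u j + d = m * b} ≃
        {u // u ∈ (Finset.univ : Finset (Fin (a + 1))).finsuppAntidiag (m * b - d)} :=
      Finsupp.equivFunOnFinite.symm.subtypeEquiv fun u => by
        simp only [Finset.mem_finsuppAntidiag, Finset.subset_univ, and_true,
          Finsupp.coe_equivFunOnFinite_symm]
        exact (eq_tsub_iff_add_eq_of_le h).symm
    rw [Nat.card_congr e, Nat.card_eq_fintype_card, Fintype.card_coe,
      Finset.card_finsuppAntidiag_nat_eq_choose, Finset.card_univ, Fintype.card_fin,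
      show a + 1 + (m * b - d) - 1 = m * b - d + a by omega]
    exact Nat.choose_symm_add
  · rw [Nat.card_eq_zero]
    exact .inl ⟨fun u => h (by have := u.2; omega)⟩

theorem card_shiftedExponents {b : Fin n → ℕ} (hb : ∀ i, 1 ≤ b i) (d : Fin n → ℕ) (s : ℕ) :
    (Nat.card (shiftedExponents a b d s) : ℚ) =
      PowerSeries.coeff s (∏ i, PowerSeries.mk fun m => (shiftedChoose (a i) (b i) (d i) m : ℚ)) := by
  classical
  let T : (Fin n →₀ ℕ) → Type := fun m =>
    ∀ i, {u : Fin (a i + 1) → ℕ // ∑ j, u j + d i = m i * b i}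
  have hfin : ∀ m i, Finite {u : Fin (a i + 1) → ℕ // ∑ j, u j + d i = m * b i} := by
    intro m i
    refine ((Set.finite_Iic fun _ : Fin (a i + 1) => m * b i).subset fun u hu j => ?_).to_subtype
    have : u j ≤ ∑ j, u j := Finset.single_le_sum (fun _ _ => Nat.zero_le _) (Finset.mem_univ j)
    have hu' : ∑ j, u j + d i = m * b i := hu
    show u j ≤ m * b i
    omega
  let f : (Σ m : {m // m ∈ (Finset.univ : Finset (Fin n)).finsuppAntidiag s}, T m.1) →
      shiftedExponents a b d s := fun x =>
    ⟨Finsupp.equivFunOnFinite.symm fun v => (x.2 v.1).1 v.2,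
      x.1.1, (Finset.mem_finsuppAntidiag.mp x.1.2).1, by
        ext i
        rw [Pi.add_apply, weight_multiweight_apply]
        exact (x.2 i).2⟩
  have hf : Function.Bijective f := by
    constructor
    · rintro ⟨⟨m, hm⟩, x⟩ ⟨⟨m', hm'⟩, x'⟩ h
      have hx : ∀ i j, (x i).1 j = (x' i).1 j := fun i j =>
        DFunLike.congr_fun (congrArg Subtype.val h) (⟨i, j⟩ : Σ i, Fin (a i + 1))
      -- The exponent determines m because each b_i is nonzero, so the union over m is disjoint.
      obtain rfl : m = m' := by
        ext i
        have h1 := (x i).2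
        have h2 := (x' i).2
        rw [Finset.sum_congr rfl fun j _ => hx i j, h2] at h1
        exact (Nat.eq_of_mul_eq_mul_right (hb i) h1).symm
      congr 1
      funext i
      exact Subtype.ext (funext (hx i))
    · rintro ⟨e, m, hm, hme⟩
      refine ⟨⟨⟨Finsupp.equivFunOnFinite.symm m, by simpa using hm⟩, fun i =>
        ⟨fun j => e ⟨i, j⟩, ?_⟩⟩, ?_⟩
      · have h := congrFun hme i
        rwa [Pi.add_apply, weight_multiweight_apply] at h
      · apply Subtype.ext
        ext ⟨i, j⟩
        rfl
  have : ∀ m, Finite (T m) := fun m => inferInstanceAs (Finite (∀ i, _))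
  rw [← Nat.card_congr (Equiv.ofBijective f hf), Nat.card_sigma, PowerSeries.coeff_prod]
  simp only [PowerSeries.coeff_mk, T, Nat.card_pi, card_functions_sum_add]
  rw [Finset.sum_coe_sort (Finset.univ.finsuppAntidiag s)
    fun m : Fin n →₀ ℕ => ∏ i, shiftedChoose (a i) (b i) (d i) (m i)]
  push_cast
  rfl

end HilbertFunction

end CorrespondenceScroll

/-! ### The degree formula -/

open CorrespondenceScroll in
theorem corollary2p3 {k : Type*} [Field k] {n : ℕ} (a b : Fin n → ℕ)
    (ha : ∀ i, 1 ≤ a i) (hb : ∀ i, 1 ≤ b i) (d : Fin n → ℤ)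
    (I : Ideal (CorrespondenceScroll.CoxRing k a))
    (hI : CorrespondenceScroll.IsMultigraded I)
    (hZ : CorrespondenceScroll.HasNoIrrelevantComponent I)
    (hd : CorrespondenceScroll.IsDivisorOfType I d) :
    CorrespondenceScroll.HasDegree (CorrespondenceScroll.scrollIdeal I b)
      (∑ i, d i * (b i : ℤ) ^ (a i - 1) * ∏ j ∈ Finset.univ.erase i, (b j : ℤ) ^ a j) := by
  obtain ⟨F, w, hF0, hF, hdw, rfl⟩ := hd.exists_eq_span ha hZ
  obtain ⟨Q, hQ, hQ1⟩ := prod_mk_shiftedChoose_sub_prod a b w ha hb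
  have hdeg : ((∑ i, d i * (b i : ℤ) ^ (a i - 1) * ∏ j ∈ Finset.univ.erase i, (b j : ℤ) ^ a j : ℤ)
      : ℚ) = Q.eval 1 := by
    rw [hQ1]
    push_cast
    exact Finset.sum_congr rfl fun i _ => by rw [hdw i, Int.cast_natCast]
  have hmk : (PowerSeries.mk fun s => (hilbertFunction (scrollIdeal (Ideal.span {F}) b) s : ℚ)) =
      ∏ i, (PowerSeries.mk fun m => (shiftedChoose (a i) (b i) 0 m : ℚ)) -
        ∏ i, PowerSeries.mk fun m => (shiftedChoose (a i) (b i) (w i) m : ℚ) := by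
    ext s
    have h := hilbertFunction_add_card (b := b) hF0 hF s
    have h0 := card_shiftedExponents (a := a) hb 0 s
    have hw := card_shiftedExponents (a := a) hb w s
    simp only [Pi.zero_apply] at h0
    rw [map_sub, ← h0, ← hw, ← h, PowerSeries.coeff_mk]
    push_cast
    ring
  unfold HasDegree
  rw [hdeg]
  by_cases h0 : Q.eval 1 = 0
  -- All summands are nonnegative and every b_j is nonzero, so a vanishing sum forces w = 0; the two
  -- products then agree and the Hilbert function is identically 0.
  · have hw0 : w = 0 := by
      ext i
      rw [hQ1, Finset.sum_eq_zero_iff_of_nonneg (fun i _ => by positivity)] at h0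
      have hpos : ∀ j, (b j : ℚ) ≠ 0 := fun j => by
        exact_mod_cast Nat.one_le_iff_ne_zero.mp (hb j)
      have := h0 i (Finset.mem_univ i)
      rw [mul_assoc, mul_eq_zero] at this
      exact_mod_cast this.resolve_right (mul_ne_zero (pow_ne_zero _ (hpos i))
        (Finset.prod_ne_zero_iff.mpr fun j _ => pow_ne_zero _ (hpos j)))
    refine ⟨0, Filter.Eventually.of_forall fun s => ?_, by simp [h0]⟩
    have := congrArg (PowerSeries.coeff s) hmk
    rw [hw0] at this
    simpa [eq_comm] using this
  · have hn : (Finset.univ : Finset (Fin n)).Nonempty := by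
      by_contra h
      exact h0 (by rw [hQ1, Finset.not_nonempty_iff_eq_empty.mp h, Finset.sum_empty])
    -- One of the two extra factors 1-X cancels against the numerator; the other makes the remaining
    -- pole order D + 1. A single block already gives a_i + 1 ≥ 2.
    obtain ⟨D, hD⟩ : ∃ D, ∑ i, (a i + 1) = D + 1 + 1 := by
      obtain ⟨i, hi⟩ := hn
      have h1 : a i + 1 ≤ ∑ i, (a i + 1) :=
        Finset.single_le_sum (f := fun i => a i + 1) (fun _ _ => Nat.zero_le _) hi
      have h2 := ha i
      exact ⟨∑ i, (a i + 1) - 2, by omega⟩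
    refine exists_polynomial_of_mk_eq (D := D) ?_ h0
    have hX : (1 - PowerSeries.X : PowerSeries ℚ) ≠ 0 := by
      intro h
      simpa using congrArg (PowerSeries.constantCoeff (R := ℚ)) h
    rw [← hmk, hD, pow_succ, ← mul_assoc, mul_comm _ (1 - PowerSeries.X)] at hQ
    exact mul_left_cancel₀ hX hQ
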